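/- Let $\sigma$ be the morphism on words over $\{a,b\}$ given by $\sigma(a)=ab$, $\sigma(b)=a$, and let $\mathbb{F}=abaababa\cdots$ be the infinite Fibonacci sequence, i.e. the fixed point of $\sigma$ beginning with $a$; write $\mathbb{F}[i,j]$ for its factor from the $i$-th to the $j$-th letter (letters are numbered from $1$). Let $f_m=|\sigma^m(a)|$ be the Fibonacci numbers with $f_0=1$, $f_1=2$, $f_{m+1}=f_m+f_{m-1}$. For $n\ge 0$ let $B(n)$ be the number of occurrences of nonempty palindromes in $\mathbb{F}[1,n]$, counted with repetition, i.e. the number of pairs $(i,j)$ with $1\le i\le j\le n$ such that $\mathbb{F}[i,j]$ is a palindrome, and put $C(m)=B(f_{m+1}-2)-B(f_m-2)$ for $m\ge 1$. Then $$C(m)=\frac{m+1}{5}f_{m+1}+\frac{m-2}{5}f_{m-1}\quad\text{for all } m\ge 1,$$ $$B(f_m-2)=\frac{m-3}{5}f_{m+2}+\frac{m-1}{5}f_m+2\quad\text{for all } m\ge 2.$$ -/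

import Mathlib

namespace FibPal

/-- The binary alphabet `{a, b}`. -/
inductive Letter where
  | a : Letter
  | b : Letter
  deriving DecidableEq

/-- The Fibonacci morphism on letters: `a ↦ ab`, `b ↦ a`. -/
def sigmaLetter : Letter → List Letter
  | Letter.a => [Letter.a, Letter.b]
  | Letter.b => [Letter.a]

/-- The Fibonacci morphism on finite words. -/
def sigma (w : List Letter) : List Letter := w.flatMap sigmaLetter

/-- The finite Fibonacci words `F_m = σ^m(a)`. -/
def finWord (m : ℕ) : List Letter := sigma^[m] [Letter.a]

/-- The Fibonacci numbers with the indexing `f_0 = 1`, `f_1 = 2`, `f_2 = 3`, `f_3 = 5`, …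
(that is, `f_{-1} = f_0 = 1`); `f_m` is the length of `σ^m(a)`, see `length_finWord`. -/
def f (m : ℕ) : ℕ := Nat.fib (m + 2)

/-- The infinite Fibonacci sequence, indexed from `0`: its `k`-th letter is the `k`-th letter of
`σ^k(a)`, a word of length at least `k + 1`. By `fibSeq_zero` and `sigma_fibPrefix` it is the fixed
point of `σ` that begins with `a`. -/
def fibSeq (k : ℕ) : Letter := (finWord k).getD k Letter.a

/-- The prefix `𝔽[1, n]` of length `n` of the Fibonacci sequence. -/
def fibPrefix (n : ℕ) : List Letter := (List.range n).map fibSeq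

/-- The factor `𝔽[i, j]` of the Fibonacci sequence from its `i`-th to its `j`-th letter, where
letters are numbered from `1` (used for `1 ≤ i ≤ j` only). -/
def factor (i j : ℕ) : List Letter := (fibPrefix j).drop (i - 1)

/-- `B(n)`: the number of occurrences of (nonempty) palindromes in `𝔽[1, n]`, counted with
repetition, i.e. the number of pairs `1 ≤ i ≤ j ≤ n` such that `𝔽[i, j]` is a palindrome. -/
def B (n : ℕ) : ℕ :=
  ((Finset.Icc 1 n ×ˢ Finset.Icc 1 n).filter
    (fun p : ℕ × ℕ => p.1 ≤ p.2 ∧ (factor p.1 p.2).Palindrome)).card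

/-- `C(m) = B(f_{m+1} - 2) - B(f_m - 2)`, as an integer. -/
def C (m : ℕ) : ℤ := (B (f (m + 1) - 2) : ℤ) - (B (f m - 2) : ℤ)

/-- `A(n)`: the number of occurrences of (nonempty) palindromes ending at position `n`. -/
def A (n : ℕ) : ℕ :=
  ((Finset.Icc 1 n).filter (fun i : ℕ => (factor i n).Palindrome)).card

/-- Sorting the palindrome occurrences by their end position. -/
theorem B_eq_sum (n : ℕ) : B n = ∑ i ∈ Finset.Icc 1 n, A i := by
  unfold B A
  rw [Finset.card_eq_sum_card_fiberwise (f := Prod.snd) (t := Finset.Icc 1 n)]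
  · refine Finset.sum_congr rfl fun j hj => ?_
    rw [Finset.mem_Icc] at hj
    refine Finset.card_bij' (fun p _ => p.1) (fun i _ => (i, j)) ?_ ?_ ?_ ?_
    · rintro ⟨x, y⟩ h
      simp only [Finset.mem_filter, Finset.mem_product, Finset.mem_Icc] at h ⊢
      obtain ⟨⟨_, h2, h3⟩, rfl⟩ := h
      exact ⟨⟨by omega, h2⟩, h3⟩
    · intro i h
      simp only [Finset.mem_filter, Finset.mem_product, Finset.mem_Icc] at h ⊢
      exact ⟨⟨⟨⟨h.1.1, by omega⟩, hj⟩, h.1.2, h.2⟩, trivial⟩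
    · rintro ⟨x, y⟩ h
      simp only [Finset.mem_filter] at h
      simp [h.2]
    · intro i h
      rfl
  · intro p hp
    simp only [Finset.coe_filter, Set.mem_ofPred_eq, Finset.mem_product] at hp
    exact hp.1.2

theorem sigma_append (u v : List Letter) : sigma (u ++ v) = sigma u ++ sigma v := by
  simp [sigma]

theorem finWord_succ (m : ℕ) : finWord (m + 1) = sigma (finWord m) := by
  simp [finWord, Function.iterate_succ_apply']

theorem finWord_add_two (m : ℕ) : finWord (m + 2) = finWord (m + 1) ++ finWord m := by
  induction m with
  | zero => decide
  | succ k ih => rw [finWord_succ (k + 2), ih, sigma_append, ← finWord_succ, ← finWord_succ,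
      ← ih]

theorem length_finWord (m : ℕ) : (finWord m).length = f m := by
  induction m using Nat.twoStepInduction with
  | zero => decide
  | one => decide
  | more k h1 h2 =>
    rw [finWord_add_two, List.length_append, h1, h2]
    unfold f
    rw [Nat.fib_add_two (n := k + 2), add_comm]

theorem lt_f (m : ℕ) : m < f m := by
  induction m using Nat.twoStepInduction with
  | zero => decide
  | one => decide
  | more k h1 h2 =>
    have h : f (k + 2) = f k + f (k + 1) := Nat.fib_add_two
    omega

theorem finWord_prefix {m n : ℕ} (h : m ≤ n) : finWord m <+: finWord n := by
  induction n, h using Nat.le_induction with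
  | base => exact List.prefix_refl _
  | succ k _ ih =>
    refine ih.trans ?_
    cases k with
    | zero => exact ⟨[Letter.b], by decide⟩
    | succ j => exact ⟨finWord j, (finWord_add_two j).symm⟩

theorem fibPrefix_eq_take {n m : ℕ} (h : n ≤ m) : fibPrefix n = (finWord m).take n := by
  have hm := lt_f m
  refine List.ext_getElem ?_ fun k h1 h2 => ?_
  · simp only [fibPrefix, List.length_map, List.length_range, List.length_take, length_finWord]
    omega
  · have hk : k < n := by simpa [fibPrefix] using h1
    have hk' : k < (finWord k).length := by rw [length_finWord]; exact lt_f k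
    simp only [fibPrefix, List.getElem_map, List.getElem_range, fibSeq, List.getElem_take]
    rw [List.getD_eq_getElem _ _ hk']
    exact (finWord_prefix (by omega : k ≤ m)).getElem hk'

/-- The Fibonacci sequence begins with `a`. -/
theorem fibSeq_zero : fibSeq 0 = Letter.a := rfl

/-- The Fibonacci sequence is fixed by `σ`: the image of each of its prefixes is a prefix. -/
theorem sigma_fibPrefix (n : ℕ) :
    sigma (fibPrefix n) = fibPrefix (sigma (fibPrefix n)).length := by
  set M := n + (sigma (fibPrefix n)).length with hM
  rw [fibPrefix_eq_take (show (sigma (fibPrefix n)).length ≤ M + 1 by omega), finWord_succ]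
  refine List.prefix_iff_eq_take.mp ?_
  rw [fibPrefix_eq_take (show n ≤ M by omega)]
  obtain ⟨t, ht⟩ := List.take_prefix n (finWord M)
  exact ⟨sigma t, by rw [← sigma_append, ht]⟩

/-- The length-`f_m` prefix of the Fibonacci sequence is `σ^m(a)`. -/
theorem fibPrefix_f (m : ℕ) : fibPrefix (f m) = finWord m := by
  have h := (lt_f m).le
  rw [fibPrefix_eq_take (le_refl (f m)), ← length_finWord m]
  exact (List.prefix_iff_eq_take.mp (finWord_prefix (by rw [length_finWord]; exact h))).symm

end FibPal

namespace FibPal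

/-! Since `aba` and `aa` are palindromes, `w` is a palindrome iff `σ(w)a` is. In `𝔽`, palindromes
that end with `a` are exactly the words `σ(w)a` at image positions with `w` a palindromic factor
(`w` empty gives the single `a`). Those that end with `b` come from some `σ(w)a` with `w` nonempty,
by deleting both outer letters `a`. This gives `A_sigmaLen_add_one` and `A_sigmaLen_succ_of_a`.

Summing over end positions expresses `B` on an image prefix through `A` and `numEndingInA`
(`B_sigmaLen`), and a second desubstitution removes `numEndingInA`. At Fibonacci lengths this yields
`B(f_{m+3}) = B(f_{m+2} - 1) + B(f_{m+1} - 1) + f_{m+3}`. Passing to `f - 2` costs boundary values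
of `A`, controlled by `exists_f_succ`; they add up to the constant `2` in `B_f_sub_two_add_two`. The
closed form solves this linear recurrence. -/

/-- The length of the image under `σ` of the prefix of length `k`. -/
def sigmaLen (k : ℕ) : ℕ := (sigma (fibPrefix k)).length

/-- The factor of the Fibonacci sequence at the positions `i, …, n - 1` (numbered from `0`). -/
def segment (i n : ℕ) : List Letter := (fibPrefix n).drop i

/-! ### Factors of `𝔽` and their positions under `σ`. -/

theorem length_fibPrefix (n : ℕ) : (fibPrefix n).length = n := by simp [fibPrefix]

theorem fibPrefix_succ (n : ℕ) : fibPrefix (n + 1) = fibPrefix n ++ [fibSeq n] := by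
  simp [fibPrefix, List.range_succ]

theorem segment_self (n : ℕ) : segment n n = [] := by
  simp [segment, length_fibPrefix]

theorem segment_succ_right {i n : ℕ} (h : i ≤ n) :
    segment i (n + 1) = segment i n ++ [fibSeq n] := by
  rw [segment, fibPrefix_succ, List.drop_append_of_le_length (by rwa [length_fibPrefix]), segment]

theorem segment_eq_cons {i n : ℕ} (h : i < n) :
    segment i n = fibSeq i :: segment (i + 1) n := by
  rw [segment, List.drop_eq_getElem_cons (by rwa [length_fibPrefix]), segment]
  simp [fibPrefix]

theorem fibPrefix_append_segment {i n : ℕ} (h : i ≤ n) :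
    fibPrefix i ++ segment i n = fibPrefix n := by
  induction n, h using Nat.le_induction with
  | base => simp [segment_self]
  | succ n h ih => rw [segment_succ_right h, ← List.append_assoc, ih, fibPrefix_succ]

theorem sigmaLen_succ (k : ℕ) : sigmaLen (k + 1) = sigmaLen k + (sigmaLetter (fibSeq k)).length := by
  simp [sigmaLen, fibPrefix_succ, sigma]

theorem sigmaLen_succ_of_a {k : ℕ} (h : fibSeq k = Letter.a) :
    sigmaLen (k + 1) = sigmaLen k + 2 := by
  rw [sigmaLen_succ, h]; rfl

theorem sigmaLen_succ_of_b {k : ℕ} (h : fibSeq k = Letter.b) :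
    sigmaLen (k + 1) = sigmaLen k + 1 := by
  rw [sigmaLen_succ, h]; rfl

theorem letter_cases (x : Letter) : x = Letter.a ∨ x = Letter.b := by
  cases x <;> simp

theorem sigmaLen_strictMono : StrictMono sigmaLen := by
  refine strictMono_nat_of_lt_succ fun k => ?_
  rcases letter_cases (fibSeq k) with h | h
  · rw [sigmaLen_succ_of_a h]; omega
  · rw [sigmaLen_succ_of_b h]; omega

theorem sigma_fibPrefix' (k : ℕ) : sigma (fibPrefix k) = fibPrefix (sigmaLen k) :=
  sigma_fibPrefix k

theorem segment_sigmaLen {i n : ℕ} (h : i ≤ n) :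
    segment (sigmaLen i) (sigmaLen n) = sigma (segment i n) := by
  have h1 := sigma_fibPrefix' n
  rw [← fibPrefix_append_segment h, sigma_append, sigma_fibPrefix',
    ← fibPrefix_append_segment (sigmaLen_strictMono.monotone h)] at h1
  exact (List.append_cancel_left h1).symm

theorem fibSeq_sigmaLen (k : ℕ) : fibSeq (sigmaLen k) = Letter.a := by
  have h := segment_sigmaLen (Nat.le_succ k)
  rw [segment_eq_cons (sigmaLen_strictMono (Nat.lt_succ_self k)),
    segment_succ_right le_rfl, segment_self] at h
  rcases letter_cases (fibSeq k) with hk | hk <;>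
    · rw [hk] at h
      exact (List.cons.inj h).1

theorem fibSeq_sigmaLen_add_one {k : ℕ} (hk : fibSeq k = Letter.a) :
    fibSeq (sigmaLen k + 1) = Letter.b := by
  have h := segment_sigmaLen (Nat.le_succ k)
  rw [Nat.succ_eq_add_one, sigmaLen_succ_of_a hk, segment_eq_cons (by omega),
    segment_eq_cons (by omega), segment_succ_right le_rfl, segment_self, segment_self, hk] at h
  exact (List.cons.inj (List.cons.inj h).2).1

/-- Every position is the first or the second one of the image of a letter. -/
theorem exists_sigmaLen (p : ℕ) :
    ∃ i, sigmaLen i = p ∨ (sigmaLen i + 1 = p ∧ fibSeq i = Letter.a) := by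
  induction p with
  | zero => exact ⟨0, Or.inl rfl⟩
  | succ p ih =>
    obtain ⟨i, rfl | ⟨rfl, h⟩⟩ := ih
    · rcases letter_cases (fibSeq i) with h | h
      · exact ⟨i, Or.inr ⟨rfl, h⟩⟩
      · exact ⟨i + 1, Or.inl (sigmaLen_succ_of_b h)⟩
    · exact ⟨i + 1, Or.inl (sigmaLen_succ_of_a h)⟩

theorem exists_sigmaLen_of_a {p : ℕ} (hp : fibSeq p = Letter.a) : ∃ i, sigmaLen i = p := by
  obtain ⟨i, h | ⟨rfl, h⟩⟩ := exists_sigmaLen p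
  · exact ⟨i, h⟩
  · rw [fibSeq_sigmaLen_add_one h] at hp
    cases hp

theorem exists_sigmaLen_of_b {p : ℕ} (hp : fibSeq p = Letter.b) :
    ∃ i, sigmaLen i + 1 = p ∧ fibSeq i = Letter.a := by
  obtain ⟨i, rfl | h⟩ := exists_sigmaLen p
  · rw [fibSeq_sigmaLen] at hp
    cases hp
  · exact ⟨i, h⟩

/-! ### Palindromes under `σ`. -/

theorem sigma_cons (x : Letter) (w : List Letter) : sigma (x :: w) = sigmaLetter x ++ sigma w := by
  simp [sigma]

/-- After appending `a`, every image begins with `a`, so the letter following the first `a` tells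
`σ(a)` (next `b`) from `σ(b)` (next `a`). -/
theorem sigma_injective : Function.Injective sigma := by
  have key : ∀ v w : List Letter, sigma v ++ [Letter.a] = sigma w ++ [Letter.a] → v = w := by
    have head (w : List Letter) : ∃ t, sigma w ++ [Letter.a] = Letter.a :: t := by
      rcases w with _ | ⟨_ | _, w⟩ <;> simp [sigma, sigmaLetter]
    intro v
    induction v with
    | nil =>
      rintro (_ | ⟨_ | _, w⟩) h
      · rfl
      · simp [sigma, sigmaLetter] at h
      · simp [sigma, sigmaLetter] at h
    | cons x v ih =>
      rintro (_ | ⟨y, w⟩) h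
      · cases x <;> simp [sigma, sigmaLetter] at h
      · obtain ⟨t, ht⟩ := head v
        obtain ⟨t', ht'⟩ := head w
        rw [sigma_cons, sigma_cons, List.append_assoc, List.append_assoc] at h
        cases x <;> cases y
        · rw [ih w (List.append_cancel_left h)]
        · rw [ht'] at h; simp [sigmaLetter] at h
        · rw [ht] at h; simp [sigmaLetter] at h
        · rw [ih w (List.append_cancel_left h)]
  exact fun v w h => key v w (by rw [h])

/-- Each `σ(x)a` is a palindrome, so the trailing `a` can be carried past the images one letter at a
time. -/
theorem reverse_sigma_append (w : List Letter) :
    (sigma w ++ [Letter.a]).reverse = sigma w.reverse ++ [Letter.a] := by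
  induction w with
  | nil => rfl
  | cons x w ih =>
    rw [sigma_cons, List.append_assoc, List.reverse_append, ih, List.reverse_cons, sigma_append]
    cases x <;> simp [sigma, sigmaLetter]

theorem palindrome_sigma_append (w : List Letter) :
    (sigma w ++ [Letter.a]).Palindrome ↔ w.Palindrome := by
  rw [List.Palindrome.iff_reverse_eq, List.Palindrome.iff_reverse_eq, reverse_sigma_append,
    List.append_left_inj, sigma_injective.eq_iff]

theorem palindrome_cons_append {α : Type*} (x : α) (l : List α) :
    (x :: (l ++ [x])).Palindrome ↔ l.Palindrome := by
  rw [List.Palindrome.iff_reverse_eq, List.Palindrome.iff_reverse_eq]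
  simp

theorem palindrome_segment_sigmaLen {i n : ℕ} (h : i ≤ n) :
    (segment (sigmaLen i) (sigmaLen n + 1)).Palindrome ↔ (segment i n).Palindrome := by
  rw [segment_succ_right (sigmaLen_strictMono.monotone h), segment_sigmaLen h, fibSeq_sigmaLen,
    palindrome_sigma_append]

/-- This segment is `σ(w)a` without its outer letters `a`; they are two distinct letters because `w`
is nonempty. -/
theorem palindrome_segment_sigmaLen_add_one {i n : ℕ} (h : i < n) :
    (segment (sigmaLen i + 1) (sigmaLen n)).Palindrome ↔ (segment i n).Palindrome := by
  have h1 := sigmaLen_strictMono h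
  rw [← palindrome_segment_sigmaLen h.le, segment_eq_cons (Nat.lt_succ_of_lt h1), segment_succ_right h1,
    fibSeq_sigmaLen, fibSeq_sigmaLen, palindrome_cons_append]

theorem fibSeq_eq_of_palindrome {i n : ℕ} (h : i ≤ n) (hp : (segment i (n + 1)).Palindrome) :
    fibSeq i = fibSeq n := by
  have h1 := hp.reverse_eq
  rw [segment_succ_right h, List.reverse_append, ← segment_succ_right h,
    segment_eq_cons (Nat.lt_succ_of_le h)] at h1
  exact (List.cons.inj h1).1.symm

/-! ### Palindromic suffixes of image prefixes. -/

theorem A_eq (n : ℕ) :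
    A n = ((Finset.range n).filter fun i => (segment i n).Palindrome).card := by
  refine Finset.card_bij' (fun i _ => i - 1) (fun i _ => i + 1) ?_ ?_ ?_ ?_
  · intro i h
    simp only [Finset.mem_filter, Finset.mem_Icc, Finset.mem_range] at h ⊢
    exact ⟨by omega, h.2⟩
  · intro i h
    simp only [Finset.mem_filter, Finset.mem_Icc, Finset.mem_range] at h ⊢
    exact ⟨by omega, h.2⟩
  · intro i h
    simp only [Finset.mem_filter, Finset.mem_Icc] at h
    omega
  · intro i h
    rfl

theorem A_sigmaLen_add_one (n : ℕ) : A (sigmaLen n + 1) = A n + 1 := by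
  -- The extra `1` is the empty factor at `i = n`, whose counterpart `σ(w)a` is the single letter
  -- `a`.
  have h0 : A n + 1 =
      ((Finset.range (n + 1)).filter fun i => (segment i n).Palindrome).card := by
    rw [Finset.range_add_one, Finset.filter_insert, if_pos (by rw [segment_self]; exact .nil),
      Finset.card_insert_of_notMem (by simp), A_eq]
  rw [h0, A_eq]
  symm
  refine Finset.card_bij (fun i _ => sigmaLen i) ?_
    (fun i _ j _ h => sigmaLen_strictMono.injective h) ?_
  · intro i h
    simp only [Finset.mem_filter, Finset.mem_range] at h ⊢
    have hi : i ≤ n := by omega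
    exact ⟨Nat.lt_succ_of_le (sigmaLen_strictMono.monotone hi),
      (palindrome_segment_sigmaLen hi).2 h.2⟩
  · intro p h
    simp only [Finset.mem_filter, Finset.mem_range] at h
    have h1 := fibSeq_eq_of_palindrome (Nat.le_of_lt_succ h.1) h.2
    rw [fibSeq_sigmaLen] at h1
    obtain ⟨i, rfl⟩ := exists_sigmaLen_of_a h1
    have hi : i ≤ n := sigmaLen_strictMono.le_iff_le.1 (Nat.le_of_lt_succ h.1)
    refine ⟨i, ?_, rfl⟩
    simp only [Finset.mem_filter, Finset.mem_range]
    exact ⟨by omega, (palindrome_segment_sigmaLen hi).1 h.2⟩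

theorem A_sigmaLen_succ_of_b {n : ℕ} (h : fibSeq n = Letter.b) :
    A (sigmaLen (n + 1)) = A n + 1 := by
  rw [sigmaLen_succ_of_b h, A_sigmaLen_add_one]

/-- The end position carries the `b` of `σ(a)`, so a palindrome ending there also starts with the
`b` of some `σ(a)`. -/
theorem A_sigmaLen_succ_of_a {n : ℕ} (hn : fibSeq n = Letter.a) :
    A (sigmaLen (n + 1)) = A (n + 1) := by
  rw [A_eq, A_eq]
  symm
  have hs := sigmaLen_succ_of_a hn
  refine Finset.card_bij (fun i _ => sigmaLen i + 1) ?_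
    (fun i _ j _ h => sigmaLen_strictMono.injective (Nat.succ_injective h)) ?_
  · intro i h
    simp only [Finset.mem_filter, Finset.mem_range] at h ⊢
    have := sigmaLen_strictMono.monotone (Nat.le_of_lt_succ h.1)
    exact ⟨by omega, (palindrome_segment_sigmaLen_add_one h.1).2 h.2⟩
  · intro p h
    simp only [Finset.mem_filter, Finset.mem_range] at h
    have h1 : fibSeq p = fibSeq (sigmaLen n + 1) :=
      fibSeq_eq_of_palindrome (by omega) (by rw [← hs]; exact h.2)
    rw [fibSeq_sigmaLen_add_one hn] at h1
    obtain ⟨i, rfl, -⟩ := exists_sigmaLen_of_b h1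
    have hi : i < n + 1 := sigmaLen_strictMono.lt_iff_lt.1 (by omega)
    refine ⟨i, ?_, rfl⟩
    simp only [Finset.mem_filter, Finset.mem_range]
    exact ⟨hi, (palindrome_segment_sigmaLen_add_one hi).1 h.2⟩

/-! ### Sums over the end positions in an image prefix. -/

theorem B_zero : B 0 = 0 := rfl

theorem B_succ (n : ℕ) : B (n + 1) = B n + A (n + 1) := by
  rw [B_eq_sum, B_eq_sum, Finset.sum_Icc_succ_top (by omega)]

/-- The number of palindrome occurrences in the prefix of length `n` that end with `a`. -/
def numEndingInA (n : ℕ) : ℕ :=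
  ∑ j ∈ Finset.range n, if fibSeq j = Letter.a then A (j + 1) else 0

theorem numEndingInA_succ (n : ℕ) :
    numEndingInA (n + 1) = numEndingInA n + if fibSeq n = Letter.a then A (n + 1) else 0 :=
  Finset.sum_range_succ _ _

/-- Each `σ(x)` contains exactly one `a`, its first letter. -/
theorem numEndingInA_sigmaLen (n : ℕ) :
    numEndingInA (sigmaLen n) = ∑ j ∈ Finset.range n, (A j + 1) := by
  induction n with
  | zero => rfl
  | succ n ih =>
    rw [Finset.sum_range_succ, ← ih]
    rcases letter_cases (fibSeq n) with h | h
    · rw [sigmaLen_succ_of_a h, numEndingInA_succ, numEndingInA_succ, fibSeq_sigmaLen,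
        fibSeq_sigmaLen_add_one h, A_sigmaLen_add_one]
      simp
    · rw [sigmaLen_succ_of_b h, numEndingInA_succ, fibSeq_sigmaLen, A_sigmaLen_add_one]
      simp

/-- The first letters of the images contribute the sum; the letters `b`, one for each `a` of the
prefix, contribute `numEndingInA n`. -/
theorem B_sigmaLen (n : ℕ) :
    B (sigmaLen n) = ∑ j ∈ Finset.range n, (A j + 1) + numEndingInA n := by
  induction n with
  | zero => rfl
  | succ n ih =>
    rw [Finset.sum_range_succ, numEndingInA_succ]
    rcases letter_cases (fibSeq n) with h | h
    · have h1 := A_sigmaLen_succ_of_a h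
      rw [sigmaLen_succ_of_a h] at h1 ⊢
      rw [B_succ, B_succ, ih, h1, A_sigmaLen_add_one, if_pos h]
      omega
    · rw [sigmaLen_succ_of_b h, B_succ, ih, A_sigmaLen_add_one, h]
      simp
      omega

theorem sum_range_succ_A (n : ℕ) : ∑ j ∈ Finset.range (n + 1), (A j + 1) = B n + (n + 1) := by
  induction n with
  | zero => rfl
  | succ n ih => rw [Finset.sum_range_succ, ih, B_succ]; omega

/-! ### Fibonacci lengths: boundary values, recurrence and closed form. -/

theorem sigmaLen_f (m : ℕ) : sigmaLen (f m) = f (m + 1) := by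
  rw [sigmaLen, fibPrefix_f, ← finWord_succ, length_finWord]

theorem f_add_two (m : ℕ) : f (m + 2) = f m + f (m + 1) := Nat.fib_add_two

/-- The last two letters of `σ^m(a)`, and the numbers of its palindromic suffixes and of those of
its prefix of length `f_m - 1`. -/
theorem exists_f_succ (m : ℕ) : ∃ n, f (m + 1) = n + 2 ∧ A (n + 1) + A (n + 2) = m + 2 ∧
    (fibSeq n = Letter.a ∧ fibSeq (n + 1) = Letter.b ∧ A (n + 2) = A (n + 1) ∨
      fibSeq n = Letter.b ∧ fibSeq (n + 1) = Letter.a ∧ A (n + 2) = A (n + 1) + 1) := by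
  induction m with
  | zero => exact ⟨0, rfl, by decide +kernel, Or.inl ⟨rfl, rfl, by decide +kernel⟩⟩
  | succ m ih =>
    obtain ⟨n, hf, hs, ⟨h0, h1, hA⟩ | ⟨h0, h1, hA⟩⟩ := ih
    -- `σ(ab) = aba`: the new ending `ba` straddles the images of both letters.
    · have e1 := sigmaLen_succ_of_a h0
      have e2 := sigmaLen_succ_of_b h1
      have a1 := A_sigmaLen_succ_of_a h0
      have a2 := A_sigmaLen_succ_of_b h1
      have l1 := fibSeq_sigmaLen_add_one h0
      have l2 := fibSeq_sigmaLen (n + 1)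
      rw [e2, e1] at a2
      rw [e1] at a1 l2
      refine ⟨sigmaLen n + 1, ?_, by rw [a1, a2]; omega, Or.inr ⟨l1, l2, ?_⟩⟩
      · rw [← sigmaLen_f, hf, e2, e1]
      · rw [a1, a2]
    -- `σ(ba) = aab`: the new ending `ab` is the image of the last letter alone.
    · have e2 := sigmaLen_succ_of_a h1
      have a1 := A_sigmaLen_add_one (n + 1)
      have a2 := A_sigmaLen_succ_of_a h1
      rw [e2] at a2
      refine ⟨sigmaLen (n + 1), ?_, by rw [a1, a2, Nat.add_right_comm, hs],
        Or.inl ⟨fibSeq_sigmaLen _, fibSeq_sigmaLen_add_one h1, ?_⟩⟩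
      · rw [← sigmaLen_f, hf, e2]
      · rw [a1, a2, hA]

/-- It turns the boundary terms of two consecutive levels into the sum over a single level given by
`exists_f_succ`. -/
theorem A_f_succ_sub_one (m : ℕ) : A (f (m + 2) - 1) = A (f (m + 1)) := by
  obtain ⟨n, hf, -, ⟨h0, h1, hA⟩ | ⟨h0, h1, hA⟩⟩ := exists_f_succ m
  · rw [← sigmaLen_f (m + 1), hf, sigmaLen_succ_of_b h1, Nat.add_sub_cancel,
      A_sigmaLen_succ_of_a h0, hA]
  · rw [← sigmaLen_f (m + 1), hf, sigmaLen_succ_of_a h1]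
    exact (A_sigmaLen_add_one _).trans hA.symm

theorem B_f_sub_two_add_two (m : ℕ) :
    B (f (m + 3) - 2) + 2 = B (f (m + 2) - 2) + B (f (m + 1) - 2) + f (m + 3) := by
  obtain ⟨n, hn, sn, -⟩ := exists_f_succ m
  obtain ⟨p, hp, sp, -⟩ := exists_f_succ (m + 1)
  obtain ⟨q, hq, sq, -⟩ := exists_f_succ (m + 2)
  have hA := A_f_succ_sub_one m
  have hB := B_sigmaLen (f (m + 2))
  have hf := f_add_two (m + 1)
  -- Writing `f (m + 2)` as `sigmaLen (f (m + 1))` allows the second desubstitution, which removes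
  -- `numEndingInA`.
  rw [sigmaLen_f, ← sigmaLen_f (m + 1), numEndingInA_sigmaLen, sigmaLen_f, hn, hp,
    sum_range_succ_A, sum_range_succ_A, hq, B_succ, B_succ, B_succ, B_succ] at hB
  rw [hn, hp] at hA
  rw [hn, hp, hq] at hf ⊢
  simp only [Nat.add_sub_cancel, Nat.add_assoc, Nat.reduceAdd, Nat.reduceSubDiff] at *
  -- The boundary terms are `A (q + 1) + A (q + 2) = m + 4` on the left and `A (p + 1) + A (n + 1) =
  -- A (n + 2) + A (n + 1) = m + 2` on the right, which leaves the `2`.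
  omega

theorem B_f_sub_two (m : ℕ) :
    (B (f (m + 1) - 2) : ℚ) = ((m : ℚ) - 2) / 5 * f (m + 3) + (m : ℚ) / 5 * f (m + 1) + 2 := by
  induction m using Nat.twoStepInduction with
  | zero =>
    have h1 : f 1 = 2 := rfl
    have h3 : f 3 = 5 := rfl
    norm_num [h1, h3, B_zero]
  | one =>
    have h2 : f 2 = 3 := rfl
    have h4 : f 4 = 8 := rfl
    have hB : B 1 = 1 := by decide +kernel
    norm_num [h2, h4, hB]
  | more m h1 h2 =>
    have h : (B (f (m + 3) - 2) : ℚ) + 2 = B (f (m + 2) - 2) + B (f (m + 1) - 2) + f (m + 3) := by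
      exact_mod_cast B_f_sub_two_add_two m
    have e3 : (f (m + 3) : ℚ) = f (m + 1) + f (m + 2) := by exact_mod_cast f_add_two (m + 1)
    have e4 : (f (m + 4) : ℚ) = f (m + 2) + f (m + 3) := by exact_mod_cast f_add_two (m + 2)
    have e5 : (f (m + 5) : ℚ) = f (m + 3) + f (m + 4) := by exact_mod_cast f_add_two (m + 3)
    simp only [Nat.add_assoc, Nat.reduceAdd] at h1 h2 ⊢
    rw [eq_sub_of_add_eq h, h1, h2, e5, e4, e3]
    push_cast
    ring

end FibPal

theorem mainTheorem4 :
    (∀ m : ℕ, 1 ≤ m →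
      (FibPal.C m : ℚ) =
        ((m : ℚ) + 1) / 5 * (FibPal.f (m + 1) : ℚ) + ((m : ℚ) - 2) / 5 * (FibPal.f (m - 1) : ℚ)) ∧
    (∀ m : ℕ, 2 ≤ m →
      (FibPal.B (FibPal.f m - 2) : ℚ) =
        ((m : ℚ) - 3) / 5 * (FibPal.f (m + 2) : ℚ) + ((m : ℚ) - 1) / 5 * (FibPal.f m : ℚ) + 2) := by
  refine ⟨fun m hm => ?_, fun m hm => ?_⟩
  · obtain ⟨k, rfl⟩ := Nat.exists_eq_add_of_le' hm
    have e2 : (FibPal.f (k + 2) : ℚ) = FibPal.f k + FibPal.f (k + 1) := by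
      exact_mod_cast FibPal.f_add_two k
    have e3 : (FibPal.f (k + 3) : ℚ) = FibPal.f (k + 1) + FibPal.f (k + 2) := by
      exact_mod_cast FibPal.f_add_two (k + 1)
    have e4 : (FibPal.f (k + 4) : ℚ) = FibPal.f (k + 2) + FibPal.f (k + 3) := by
      exact_mod_cast FibPal.f_add_two (k + 2)
    have h1 := FibPal.B_f_sub_two k
    have h2 := FibPal.B_f_sub_two (k + 1)
    simp only [Nat.add_assoc, Nat.reduceAdd] at h1 h2 ⊢
    rw [FibPal.C]
    push_cast
    simp only [Nat.add_assoc, Nat.reduceAdd]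
    rw [h1, h2, e4, e3, e2]
    push_cast
    ring
  · obtain ⟨k, rfl⟩ := Nat.exists_eq_add_of_le' (show 1 ≤ m by omega)
    rw [FibPal.B_f_sub_two k]
    push_cast
    ring
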